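/- Let $N,M\ge 0$ and $K^{(1)},\dots,K^{(N)}$ be integers, $K^{(i)}\ge 1$, and $L=\sum_i K^{(i)}$. For each $i$ let $P^{(i)}\in\{0,1\}^{K^{(i)}\times M}$ be a row-partial permutation matrix, i.e. each row contains exactly one $1$ and each column at most one $1$. Let $P\in\mathbb R^{L\times M}$ be the vertical concatenation of $P^{(1)},\dots,P^{(N)}$, let $Q=PP^\top\in\mathbb R^{L\times L}$ and $C=-Q$. Index rows and columns of $L\times L$ matrices by pairs $(i,k)$, $1\le i\le N$, $1\le k\le K^{(i)}$, and write $X^{(i,j)}\in\mathbb R^{K^{(i)}\times K^{(j)}}$ for the blocks of $X$. For symmetric $X\succeq 0$ let $S(X)=\operatorname{Tr}[X\log X]-\operatorname{Tr}[X]$ be the von Neumann entropy (with $0\log 0=0$). For $\beta>0$ consider the problem $$\text{minimize}\quad \operatorname{Tr}[CX]+\beta^{-1}S(X)\quad\text{over symmetric } X\in\mathbb R^{L\times L},\ X\succeq 0,$$ subject to one of the following sets of constraints: - (strong) $X^{(i,i)}=\mathbf I_{K^{(i)}}$ for all $i$; - (weak) $\operatorname{diag}(X)=\mathbf 1_L$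 and $\operatorname{Tr}\big[X^{(i,i)}\,\mathbf 1_{K^{(i)}}\mathbf 1_{K^{(i)}}^\top/K^{(i)}\big]=1$ for all $i$; - (GW-type) $\operatorname{diag}(X)=\mathbf 1_L$. Then for each of the three problems and each $\beta>0$ there is a unique minimizer $X_\beta$, and $$\lim_{\beta\to\infty}X_\beta=Q.$$ Moreover, with $\mathcal I_m=\{(i,k): P^{(i)}_{km}=1\}$ and $L_m=|\mathcal I_m|$ for $m=1,\dots,M$, in each of the three cases $X_\beta$ is block-diagonal with respect to the partition of the indices into $\mathcal I_1,\dots,\mathcal I_M$ (entries with row in $\mathcal I_m$ and column in $\mathcal I_{m'}$, $m\ne m'$, vanish), and its diagonal blocks are $$[X_\beta]_{\mathcal I_m,\mathcal I_m}=\tau_{\beta,m}\,\mathbf I_{L_m}+(1-\tau_{\beta,m})\,\mathbf 1_{L_m}\mathbf 1_{L_m}^\top,\qquad \tau_{\beta,m}=\frac{L_m}{L_m+e^{\beta L_m}-1}$$ (an empty block when $L_m=0$). -/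

import Mathlib

namespace PermSync

open Matrix

/-- Keypoints `(i, k)`: the `k`-th keypoint of the `i`-th image, image `i` having `K i` of them.
These are the row indices of the large `L × L` matrices, `L = ∑ i, K i`. -/
abbrev Keypoint {N : ℕ} (K : Fin N → ℕ) : Type := Σ i : Fin N, Fin (K i)

/-- A row-partial permutation matrix: entries in `{0, 1}`, exactly one `1` in each row and at most
one `1` in each column; equivalently, a selection of rows of a permutation matrix. -/
structure IsRowPartialPerm {k m : ℕ} (A : Matrix (Fin k) (Fin m) ℝ) : Prop where
  zero_or_one : ∀ a b, A a b = 0 ∨ A a b = 1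
  row : ∀ a, ∃! b, A a b = 1
  column : ∀ a a' b, A a b = 1 → A a' b = 1 → a = a'

/-- The vertical concatenation `P` of the blocks `P⁽¹⁾, …, P⁽ᴺ⁾`. -/
def stack {N M : ℕ} {K : Fin N → ℕ} (P : ∀ i, Matrix (Fin (K i)) (Fin M) ℝ) :
    Matrix (Keypoint K) (Fin M) ℝ :=
  Matrix.of fun p m => P p.1 p.2 m

/-- The uncorrupted data `Q = P Pᵀ`. -/
def data {N M : ℕ} {K : Fin N → ℕ} (P : ∀ i, Matrix (Fin (K i)) (Fin M) ℝ) :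
    Matrix (Keypoint K) (Keypoint K) ℝ :=
  stack P * (stack P)ᵀ

/-- The block `X⁽ⁱʲ⁾` of a large matrix. -/
def block {N : ℕ} {K : Fin N → ℕ} (X : Matrix (Keypoint K) (Keypoint K) ℝ) (i j : Fin N) :
    Matrix (Fin (K i)) (Fin (K j)) ℝ :=
  Matrix.of fun a b => X ⟨i, a⟩ ⟨j, b⟩

/-- The all-ones matrix `1 1ᵀ`. -/
def allOnes (n : Type*) : Matrix n n ℝ := Matrix.of fun _ _ => 1

/-- The von Neumann entropy `S(X) = Tr[X log X] - Tr[X]` of a positive semidefinite matrix. The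
logarithm is the spectral one; as `Real.log 0 = 0`, the convention `0 log 0 = 0` is in force. -/
noncomputable def entropy {n : Type*} [Fintype n] [DecidableEq n] (X : Matrix n n ℝ) : ℝ :=
  (X * cfc Real.log X).trace - X.trace

/-- The regularized objective `Tr[C X] + β⁻¹ S(X)`. -/
noncomputable def objective {n : Type*} [Fintype n] [DecidableEq n]
    (C : Matrix n n ℝ) (β : ℝ) (X : Matrix n n ℝ) : ℝ :=
  (C * X).trace + β⁻¹ * entropy X

/-- The three semidefinite relaxations. -/
inductive Relaxation
  | strong
  | weak
  | gw

/-- The feasible set of each relaxation. -/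
def feasible {N : ℕ} (K : Fin N → ℕ) : Relaxation → Set (Matrix (Keypoint K) (Keypoint K) ℝ)
  | .strong => {X | (∀ i, block X i i = 1) ∧ X.PosSemidef}
  | .weak => {X | (∀ p, X p p = 1) ∧
      (∀ i, (block X i i * ((K i : ℝ)⁻¹ • allOnes (Fin (K i)))).trace = 1) ∧ X.PosSemidef}
  | .gw => {X | (∀ p, X p p = 1) ∧ X.PosSemidef}

/-- `X` solves: minimize `Tr[C X] + β⁻¹ S(X)` over the feasible set of the relaxation `r`. -/
def IsRegSolution {N : ℕ} {K : Fin N → ℕ} (r : Relaxation)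
    (C : Matrix (Keypoint K) (Keypoint K) ℝ) (β : ℝ)
    (X : Matrix (Keypoint K) (Keypoint K) ℝ) : Prop :=
  X ∈ feasible K r ∧ IsMinOn (objective C β) (feasible K r) X

/-- The set `I_m` of keypoints that correspond to the registry point `m`. -/
def registryClass {N M : ℕ} {K : Fin N → ℕ} (P : ∀ i, Matrix (Fin (K i)) (Fin M) ℝ)
    (m : Fin M) : Set (Keypoint K) :=
  {p | P p.1 p.2 m = 1}

/-- The mixing coefficient `τ = L / (L + e^{βL} - 1)`. -/
noncomputable def mixing (β : ℝ) (L : ℕ) : ℝ :=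
  (L : ℝ) / ((L : ℝ) + Real.exp (β * L) - 1)

end PermSync

/-! All three feasible sets lie in the set of positive semidefinite `X` with unit diagonal, on which
`Tr X` and `Tr[X D]`, for a fixed diagonal `D`, are constant. Put `H = βQ + D` with `D = diag(log
τ)`, which is `gibbsLog`. If `exp H` has unit diagonal, then `β` times the excess of the objective
at `X` over its value at `exp H` is the relative entropy `S(X) - Tr[X H] + Tr[exp H]`
(`objective_sub_objective_gibbs`). Klein's inequality makes this nonnegative, with equality only at
`X = exp H`.

On a class of size `L`, `Q` is the all-ones matrix `J`, so `exp H` is `τ (I + (e^{βL} - 1)/L J)`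
there; the value of `τ` is the one that makes the diagonal `1` (`cfc_exp_gibbsLog`). Keypoints of
one image lie in distinct classes, so `exp H` also meets the strong and weak constraints and solves
all three problems. Finally `τ → 0` as `β → ∞`. -/

namespace PermSync

open Matrix

/-! ### Klein's inequality and its equality case -/

section Klein

variable {n : Type*} [Fintype n] [DecidableEq n]

lemma cfc_eq_conj_diagonal {A : Matrix n n ℝ} (hA : A.IsHermitian) (f : ℝ → ℝ) :
    cfc f A = (hA.eigenvectorUnitary : Matrix n n ℝ) *
      diagonal (fun i => f (hA.eigenvalues i)) * (hA.eigenvectorUnitary : Matrix n n ℝ)ᵀ := by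
  rw [hA.cfc_eq, IsHermitian.cfc, Unitary.conjStarAlgAut_apply]
  rfl

lemma transpose_mul_eigenvectorUnitary {A : Matrix n n ℝ} (hA : A.IsHermitian) :
    (hA.eigenvectorUnitary : Matrix n n ℝ)ᵀ * (hA.eigenvectorUnitary : Matrix n n ℝ) = 1 :=
  Unitary.coe_star_mul_self hA.eigenvectorUnitary

lemma eigenvectorUnitary_mul_transpose {A : Matrix n n ℝ} (hA : A.IsHermitian) :
    (hA.eigenvectorUnitary : Matrix n n ℝ) * (hA.eigenvectorUnitary : Matrix n n ℝ)ᵀ = 1 :=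
  Unitary.coe_mul_star_self hA.eigenvectorUnitary

lemma continuousOn_spectrum (A : Matrix n n ℝ) (f : ℝ → ℝ) : ContinuousOn f (spectrum ℝ A) :=
  A.finite_spectrum.continuousOn f

/-- An eigenvector of a symmetric matrix is an eigenvector of every function of the matrix. -/
lemma cfc_mulVec_of_eigenvector {A : Matrix n n ℝ} (hA : A.IsHermitian) (f : ℝ → ℝ)
    {v : n → ℝ} {t : ℝ} (hv : A *ᵥ v = t • v) : cfc f A *ᵥ v = f t • v := by
  set U : Matrix n n ℝ := (hA.eigenvectorUnitary : Matrix n n ℝ) with hU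
  have hUU : U * Uᵀ = 1 := eigenvectorUnitary_mul_transpose hA
  have hUU' : Uᵀ * U = 1 := transpose_mul_eigenvectorUnitary hA
  have hid : A = U * diagonal (fun i => hA.eigenvalues i) * Uᵀ := by
    conv_lhs => rw [← cfc_id' ℝ A hA.isSelfAdjoint, cfc_eq_conj_diagonal hA]
  have hw : ∀ i, hA.eigenvalues i * (Uᵀ *ᵥ v) i = t * (Uᵀ *ᵥ v) i := by
    intro i
    have h1 : Uᵀ *ᵥ (A *ᵥ v) = diagonal (fun i => hA.eigenvalues i) *ᵥ (Uᵀ *ᵥ v) := by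
      conv_lhs => rw [hid]
      rw [mulVec_mulVec, mulVec_mulVec, Matrix.mul_assoc, ← Matrix.mul_assoc, hUU',
        Matrix.one_mul]
    rw [hv, mulVec_smul] at h1
    have := congrFun h1 i
    rw [mulVec_diagonal] at this
    simpa using this.symm
  -- Wherever the coordinate of `v` in the eigenbasis is nonzero, the eigenvalue must be `t`.
  have key : diagonal (fun i => f (hA.eigenvalues i)) *ᵥ (Uᵀ *ᵥ v) = f t • (Uᵀ *ᵥ v) := by
    ext i
    rw [mulVec_diagonal, Pi.smul_apply, smul_eq_mul]
    by_cases h0 : (Uᵀ *ᵥ v) i = 0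
    · simp [h0]
    · rw [mul_right_cancel₀ h0 (hw i)]
  rw [cfc_eq_conj_diagonal hA, ← hU, ← mulVec_mulVec, ← mulVec_mulVec, key, mulVec_smul,
    mulVec_mulVec, hUU, one_mulVec]

/-- The overlaps `⟨uₐ, v_b⟩` of the eigenvectors of two symmetric matrices. -/
noncomputable def overlap {A B : Matrix n n ℝ} (hA : A.IsHermitian) (hB : B.IsHermitian) :
    Matrix n n ℝ :=
  (hA.eigenvectorUnitary : Matrix n n ℝ)ᵀ * (hB.eigenvectorUnitary : Matrix n n ℝ)

lemma trace_cfc_mul_cfc {A B : Matrix n n ℝ} (hA : A.IsHermitian) (hB : B.IsHermitian)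
    (f g : ℝ → ℝ) :
    (cfc f A * cfc g B).trace =
      ∑ a, ∑ b, f (hA.eigenvalues a) * g (hB.eigenvalues b) * overlap hA hB a b ^ 2 := by
  have h : (cfc f A * cfc g B).trace =
      (diagonal (fun i => f (hA.eigenvalues i)) * overlap hA hB *
        (diagonal (fun i => g (hB.eigenvalues i)) * (overlap hA hB)ᵀ)).trace := by
    rw [cfc_eq_conj_diagonal hA, cfc_eq_conj_diagonal hB, overlap, transpose_mul,
      transpose_transpose, Matrix.mul_assoc, Matrix.mul_assoc, Matrix.trace_mul_comm]
    simp only [Matrix.mul_assoc]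
  rw [h]
  simp only [Matrix.trace, diag_apply, Matrix.mul_apply (M := diagonal _ * _), diagonal_mul,
    transpose_apply]
  exact Finset.sum_congr rfl fun a _ => Finset.sum_congr rfl fun b _ => by ring

/-- For `x > 0` this is `1 + t ≤ exp t` at `t = h - log x`, multiplied by `x`. -/
lemma klein_scalar_nonneg {x : ℝ} (hx : 0 ≤ x) (h : ℝ) :
    0 ≤ x * Real.log x - x * h - x + Real.exp h := by
  rcases hx.eq_or_lt with rfl | hx
  · simpa using (Real.exp_pos h).le
  · have h1 := Real.add_one_le_exp (h - Real.log x)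
    rw [Real.exp_sub, Real.exp_log hx, le_div_iff₀ hx] at h1
    linarith

lemma eq_exp_of_klein_scalar_eq_zero {x : ℝ} (hx : 0 ≤ x) {h : ℝ}
    (h0 : x * Real.log x - x * h - x + Real.exp h = 0) : x = Real.exp h := by
  rcases hx.eq_or_lt with rfl | hx
  · simp at h0
  · by_contra hne
    have hne' : h - Real.log x ≠ 0 := by
      intro h'
      exact hne (by rw [sub_eq_zero.mp h', Real.exp_log hx])
    have h1 := Real.add_one_lt_exp hne'
    rw [Real.exp_sub, Real.exp_log hx, lt_div_iff₀ hx] at h1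
    linarith

/-- Inserting the identity as the constant function `1` of `X` or `H` gives every trace the same
weights, the squared overlaps, so the scalar Klein expression appears termwise. -/
lemma relativeEntropy_eq_sum {X H : Matrix n n ℝ} (hX : X.IsHermitian) (hH : H.IsHermitian) :
    entropy X - (X * H).trace + (cfc Real.exp H).trace =
      ∑ a, ∑ b, (hX.eigenvalues a * Real.log (hX.eigenvalues a)
        - hX.eigenvalues a * hH.eigenvalues b - hX.eigenvalues a
        + Real.exp (hH.eigenvalues b)) * overlap hX hH a b ^ 2 := by
  have hX' := hX.isSelfAdjoint
  have hH' := hH.isSelfAdjoint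
  have e1 : X * cfc Real.log X = cfc (fun x => x * Real.log x) X * cfc (fun _ => (1 : ℝ)) H := by
    rw [cfc_const_one ℝ H (ha := hH'), mul_one, cfc_mul (fun x => x) Real.log X
      (continuousOn_spectrum _ _) (continuousOn_spectrum _ _), cfc_id' ℝ X hX']
  have e2 : X * H = cfc (fun x : ℝ => x) X * cfc (fun x : ℝ => x) H := by
    rw [cfc_id' ℝ X hX', cfc_id' ℝ H hH']
  have e3 : X = cfc (fun x : ℝ => x) X * cfc (fun _ => (1 : ℝ)) H := by
    rw [cfc_id' ℝ X hX', cfc_const_one ℝ H (ha := hH'), mul_one]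
  have e4 : cfc Real.exp H = cfc (fun _ => (1 : ℝ)) X * cfc Real.exp H := by
    rw [cfc_const_one ℝ X (ha := hX'), one_mul]
  have t1 := congrArg trace e1
  have t2 := congrArg trace e2
  have t3 := congrArg trace e3
  have t4 := congrArg trace e4
  rw [trace_cfc_mul_cfc hX hH] at t1 t2 t3 t4
  rw [entropy, t1, t2, t3, t4]
  simp only [← Finset.sum_sub_distrib, ← Finset.sum_add_distrib]
  exact Finset.sum_congr rfl fun a _ => Finset.sum_congr rfl fun b _ => by ring

/-- **Klein's inequality**. -/
lemma relativeEntropy_nonneg {X H : Matrix n n ℝ} (hX : X.PosSemidef) (hH : H.IsHermitian) :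
    0 ≤ entropy X - (X * H).trace + (cfc Real.exp H).trace := by
  rw [relativeEntropy_eq_sum hX.isHermitian hH]
  exact Finset.sum_nonneg fun a _ => Finset.sum_nonneg fun b _ =>
    mul_nonneg (klein_scalar_nonneg (hX.eigenvalues_nonneg a) _) (sq_nonneg _)

/-- The equality case of Klein's inequality. -/
lemma eq_cfc_exp_of_relativeEntropy_eq_zero {X H : Matrix n n ℝ} (hX : X.PosSemidef)
    (hH : H.IsHermitian)
    (h0 : entropy X - (X * H).trace + (cfc Real.exp H).trace = 0) : X = cfc Real.exp H := by
  have hXh := hX.isHermitian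
  rw [relativeEntropy_eq_sum hXh hH] at h0
  have hterm : ∀ a b, 0 ≤ (hXh.eigenvalues a * Real.log (hXh.eigenvalues a)
        - hXh.eigenvalues a * hH.eigenvalues b - hXh.eigenvalues a
        + Real.exp (hH.eigenvalues b)) * overlap hXh hH a b ^ 2 := fun a b =>
    mul_nonneg (klein_scalar_nonneg (hX.eigenvalues_nonneg a) _) (sq_nonneg _)
  -- Each term of the sum vanishes: either the overlap is zero or the two eigenvalues match. Hence
  -- the overlap matrix intertwines the two diagonal forms.
  have hz : ∀ a b, hXh.eigenvalues a * overlap hXh hH a b =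
      overlap hXh hH a b * Real.exp (hH.eigenvalues b) := by
    intro a b
    have h1 := (Finset.sum_eq_zero_iff_of_nonneg
      fun a _ => Finset.sum_nonneg fun b _ => hterm a b).1 h0 a (Finset.mem_univ a)
    have h2 := (Finset.sum_eq_zero_iff_of_nonneg fun b _ => hterm a b).1 h1 b (Finset.mem_univ b)
    rcases mul_eq_zero.1 h2 with h3 | h3
    · rw [eq_exp_of_klein_scalar_eq_zero (hX.eigenvalues_nonneg a) h3, mul_comm]
    · rw [pow_eq_zero_iff two_ne_zero] at h3
      simp [h3]
  have hmat : diagonal (fun i => hXh.eigenvalues i) * overlap hXh hH =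
      overlap hXh hH * diagonal (fun i => Real.exp (hH.eigenvalues i)) := by
    ext a b
    rw [diagonal_mul, mul_diagonal, hz]
  set U : Matrix n n ℝ := (hXh.eigenvectorUnitary : Matrix n n ℝ) with hU
  set V : Matrix n n ℝ := (hH.eigenvectorUnitary : Matrix n n ℝ) with hV
  have hUU : U * Uᵀ = 1 := eigenvectorUnitary_mul_transpose hXh
  have hVV : V * Vᵀ = 1 := eigenvectorUnitary_mul_transpose hH
  have hid : X = U * diagonal (fun i => hXh.eigenvalues i) * Uᵀ := by
    conv_lhs => rw [← cfc_id' ℝ X hXh.isSelfAdjoint, cfc_eq_conj_diagonal hXh]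
  calc X = U * diagonal (fun i => hXh.eigenvalues i) * Uᵀ * (V * Vᵀ) := by
        rw [hVV, Matrix.mul_one]; exact hid
    _ = U * (diagonal (fun i => hXh.eigenvalues i) * overlap hXh hH) * Vᵀ := by
        simp only [overlap, ← hU, ← hV, Matrix.mul_assoc]
    _ = U * Uᵀ * (V * diagonal (fun i => Real.exp (hH.eigenvalues i)) * Vᵀ) := by
        rw [hmat]; simp only [overlap, ← hU, ← hV, Matrix.mul_assoc]
    _ = cfc Real.exp H := by
        rw [hUU, Matrix.one_mul, cfc_eq_conj_diagonal hH]

lemma posSemidef_cfc_exp {H : Matrix n n ℝ} (hH : H.IsHermitian) :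
    (cfc Real.exp H).PosSemidef := by
  rw [cfc_eq_conj_diagonal hH]
  exact (PosSemidef.diagonal fun i => (Real.exp_pos _).le).mul_mul_conjTranspose_same _

lemma relativeEntropy_cfc_exp {H : Matrix n n ℝ} (hH : H.IsHermitian) :
    entropy (cfc Real.exp H) - (cfc Real.exp H * H).trace + (cfc Real.exp H).trace = 0 := by
  have : cfc Real.log (cfc Real.exp H) = H := by
    rw [← cfc_comp' Real.log Real.exp H ((H.finite_spectrum.image _).continuousOn _) (continuousOn_spectrum _ _)
      hH.isSelfAdjoint]
    simp only [Real.log_exp]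
    exact cfc_id' ℝ H hH.isSelfAdjoint
  rw [entropy, this]
  ring

end Klein

/-! ### The Gibbs matrix of a partition -/

section Classes

variable {n ι : Type*} [Fintype n] [DecidableEq n] [DecidableEq ι]

/-- The number of indices in the same class as `p`. -/
def classCard (c : n → ι) (p : n) : ℕ := (Finset.univ.filter fun q => c q = c p).card

/-- The indicator matrix of the relation `c p = c q`. -/
def classMatrix (c : n → ι) : Matrix n n ℝ := Matrix.of fun p q => if c p = c q then 1 else 0

/-- The explicit minimizer. -/
noncomputable def gibbs (c : n → ι) (β : ℝ) : Matrix n n ℝ := Matrix.of fun p q =>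
  if p = q then 1 else if c p = c q then 1 - mixing β (classCard c p) else 0

/-- The logarithm of the explicit minimizer. -/
noncomputable def gibbsLog (c : n → ι) (β : ℝ) : Matrix n n ℝ :=
  β • classMatrix c + diagonal fun p => Real.log (mixing β (classCard c p))

omit [DecidableEq n] in
lemma classCard_pos (c : n → ι) (p : n) : 0 < classCard c p :=
  Finset.card_pos.2 ⟨p, by simp⟩

omit [DecidableEq n] in
lemma classCard_congr {c : n → ι} {p q : n} (h : c p = c q) : classCard c p = classCard c q := by
  rw [classCard, classCard, h]

lemma mixing_denom_pos (β : ℝ) {L : ℕ} (hL : 0 < L) :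
    0 < (L : ℝ) + Real.exp (β * L) - 1 := by
  have : (1 : ℝ) ≤ L := by exact_mod_cast hL
  linarith [Real.exp_pos (β * L)]

lemma mixing_pos (β : ℝ) {L : ℕ} (hL : 0 < L) : 0 < mixing β L :=
  div_pos (by exact_mod_cast hL) (mixing_denom_pos β hL)

lemma isHermitian_gibbsLog (c : n → ι) (β : ℝ) : (gibbsLog c β).IsHermitian := by
  ext p q
  by_cases h : p = q
  · subst h; simp [gibbsLog, classMatrix]
  · simp [gibbsLog, classMatrix, diagonal_apply_ne _ h, diagonal_apply_ne' _ h, eq_comm]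

omit [DecidableEq n] in
lemma classMatrix_mulVec_indicator (c : n → ι) (p : n) :
    classMatrix c *ᵥ (fun q => if c q = c p then (1 : ℝ) else 0) =
      (classCard c p : ℝ) • fun q => if c q = c p then (1 : ℝ) else 0 := by
  ext q
  simp only [mulVec, dotProduct, classMatrix, of_apply, Pi.smul_apply, smul_eq_mul]
  by_cases h : c q = c p
  · simp only [h, classCard, Finset.card_filter, if_true, mul_one, Nat.cast_sum]
    refine Finset.sum_congr rfl fun r _ => ?_
    by_cases h1 : c r = c p
    · simp [h1]
    · simp [h1]
  · simp only [h, if_false, mul_zero]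
    refine Finset.sum_eq_zero fun r _ => ?_
    by_cases h1 : c r = c p
    · rw [if_neg fun h2 => h (h2.trans h1), zero_mul]
    · rw [if_neg h1, mul_zero]

lemma classMatrix_mulVec_single (c : n → ι) (p : n) :
    classMatrix c *ᵥ Pi.single p 1 = fun q => if c q = c p then (1 : ℝ) else 0 := by
  ext q
  simp [classMatrix]

lemma gibbsLog_mulVec_indicator (c : n → ι) (β : ℝ) (p : n) :
    gibbsLog c β *ᵥ (fun q => if c q = c p then (1 : ℝ) else 0) =
      (β * classCard c p + Real.log (mixing β (classCard c p))) •
        fun q => if c q = c p then (1 : ℝ) else 0 := by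
  rw [gibbsLog, add_mulVec, smul_mulVec, classMatrix_mulVec_indicator]
  ext q
  simp only [Pi.add_apply, mulVec_diagonal, Pi.smul_apply, smul_eq_mul]
  by_cases h : c q = c p
  · rw [classCard_congr h]; ring
  · simp [h]

/-- The centered basis vector sums to zero over its class, so `classMatrix` annihilates it and only
the diagonal part acts. -/
lemma gibbsLog_mulVec_centered (c : n → ι) (β : ℝ) (p : n) :
    gibbsLog c β *ᵥ (Pi.single p 1 -
        (classCard c p : ℝ)⁻¹ • fun q => if c q = c p then (1 : ℝ) else 0) =
      Real.log (mixing β (classCard c p)) • (Pi.single p 1 -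
        (classCard c p : ℝ)⁻¹ • fun q => if c q = c p then (1 : ℝ) else 0) := by
  have hL : (classCard c p : ℝ) ≠ 0 := by exact_mod_cast (classCard_pos c p).ne'
  rw [mulVec_sub, mulVec_smul, gibbsLog_mulVec_indicator, gibbsLog, add_mulVec, smul_mulVec,
    classMatrix_mulVec_single]
  ext q
  simp only [Pi.add_apply, Pi.sub_apply, mulVec_diagonal, Pi.smul_apply, smul_eq_mul]
  by_cases h : q = p
  · subst h; simp; field_simp; ring
  · by_cases h1 : c q = c p
    · simp [h, h1]; field_simp; ring
    · simp [h, h1]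

/-- Column `p` of the exponential is its value at the basis vector of `p`, which is a multiple of
the class indicator plus a centered vector, both eigenvectors of `gibbsLog`. -/
lemma cfc_exp_gibbsLog (c : n → ι) (β : ℝ) :
    cfc Real.exp (gibbsLog c β) = gibbs c β := by
  have hH := isHermitian_gibbsLog c β
  ext q p
  have hLpos := classCard_pos c p
  have hL : (classCard c p : ℝ) ≠ 0 := by exact_mod_cast hLpos.ne'
  have hden := (mixing_denom_pos β hLpos).ne'
  have h1 := cfc_mulVec_of_eigenvector hH Real.exp (gibbsLog_mulVec_indicator c β p)
  have h2 := cfc_mulVec_of_eigenvector hH Real.exp (gibbsLog_mulVec_centered c β p)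
  rw [mulVec_sub, mulVec_smul, h1, Real.exp_add, Real.exp_log (mixing_pos β hLpos),
    sub_eq_iff_eq_add] at h2
  have h3 := congrFun h2 q
  rw [mulVec_single_one] at h3
  change cfc Real.exp (gibbsLog c β) q p = _ at h3
  rw [h3]
  simp only [Pi.add_apply, Pi.sub_apply, Pi.smul_apply, smul_eq_mul, gibbs, of_apply]
  by_cases h : q = p
  · subst h; simp only [mixing, Pi.single_eq_same, if_true]
    generalize Real.exp (β * classCard c q) = E at *
    field_simp
    ring
  · by_cases h1 : c q = c p
    · simp only [mixing, Pi.single_eq_of_ne h, h, h1, classCard_congr h1, if_true, if_false]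
      generalize Real.exp (β * classCard c p) = E at *
      field_simp
      ring
    · simp [h, h1]

lemma posSemidef_gibbs (c : n → ι) (β : ℝ) : (gibbs c β).PosSemidef := by
  rw [← cfc_exp_gibbsLog c β]
  exact posSemidef_cfc_exp (isHermitian_gibbsLog c β)

lemma trace_mul_gibbsLog (c : n → ι) (β : ℝ) {X : Matrix n n ℝ} (hX : ∀ p, X p p = 1) :
    (X * gibbsLog c β).trace = β * (classMatrix c * X).trace +
      ∑ p, Real.log (mixing β (classCard c p)) := by
  rw [gibbsLog, Matrix.mul_add, trace_add, Matrix.mul_smul, trace_smul, trace_mul_comm,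
    smul_eq_mul]
  simp [Matrix.trace, mul_diagonal, hX]

lemma gibbs_diag (c : n → ι) (β : ℝ) (p : n) : gibbs c β p p = 1 := by simp [gibbs]

/-- The excess of the objective over its value at the minimizer is a relative entropy. -/
lemma objective_sub_objective_gibbs (c : n → ι) {β : ℝ} (hβ : 0 < β) {X : Matrix n n ℝ}
    (hX : ∀ p, X p p = 1) :
    β * (objective (-classMatrix c) β X - objective (-classMatrix c) β (gibbs c β)) =
      entropy X - (X * gibbsLog c β).trace + (cfc Real.exp (gibbsLog c β)).trace := by
  have h := relativeEntropy_cfc_exp (isHermitian_gibbsLog c β)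
  rw [cfc_exp_gibbsLog c β, trace_mul_gibbsLog c β (gibbs_diag c β)] at h
  rw [cfc_exp_gibbsLog c β, trace_mul_gibbsLog c β hX, objective, objective]
  simp only [Matrix.neg_mul, trace_neg]
  field_simp
  linarith

lemma objective_gibbs_le (c : n → ι) {β : ℝ} (hβ : 0 < β) {X : Matrix n n ℝ}
    (hX : ∀ p, X p p = 1) (hX' : X.PosSemidef) :
    objective (-classMatrix c) β (gibbs c β) ≤ objective (-classMatrix c) β X := by
  have h := relativeEntropy_nonneg hX' (isHermitian_gibbsLog c β)
  rw [← objective_sub_objective_gibbs c hβ hX] at h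
  linarith [nonneg_of_mul_nonneg_right h hβ]

lemma eq_gibbs_of_objective_le (c : n → ι) {β : ℝ} (hβ : 0 < β) {X : Matrix n n ℝ}
    (hX : ∀ p, X p p = 1) (hX' : X.PosSemidef)
    (h : objective (-classMatrix c) β X ≤ objective (-classMatrix c) β (gibbs c β)) :
    X = gibbs c β := by
  rw [← cfc_exp_gibbsLog c β]
  refine eq_cfc_exp_of_relativeEntropy_eq_zero hX' (isHermitian_gibbsLog c β) ?_
  rw [← objective_sub_objective_gibbs c hβ hX, le_antisymm h (objective_gibbs_le c hβ hX hX'),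
    sub_self, mul_zero]

lemma tendsto_mixing {L : ℕ} (hL : 0 < L) :
    Filter.Tendsto (fun β => mixing β L) Filter.atTop (nhds 0) := by
  refine Filter.Tendsto.const_div_atTop ?_ _
  refine Filter.tendsto_atTop_add_const_right _ _ (Filter.tendsto_atTop_add_const_left _ _ ?_)
  exact Real.tendsto_exp_atTop.comp
    (Filter.tendsto_id.atTop_mul_const (by exact_mod_cast hL : (0 : ℝ) < L))

lemma tendsto_gibbs (c : n → ι) :
    Filter.Tendsto (gibbs c) Filter.atTop (nhds (classMatrix c)) := by
  refine tendsto_pi_nhds.2 fun p => tendsto_pi_nhds.2 fun q => ?_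
  simp only [gibbs, classMatrix, of_apply]
  by_cases h : p = q
  · simp [h]
  · by_cases h1 : c p = c q
    · simpa [h, h1] using (tendsto_mixing (classCard_pos c p)).const_sub 1
    · simp [h, h1]

end Classes

/-! ### Keypoint classes and feasibility -/

section Registry

variable {N M : ℕ} {K : Fin N → ℕ} {P : ∀ i, Matrix (Fin (K i)) (Fin M) ℝ}

/-- The registry point to which a keypoint corresponds. -/
noncomputable def registryPoint (hP : ∀ i, IsRowPartialPerm (P i)) (p : Keypoint K) : Fin M :=
  ((hP p.1).row p.2).choose

lemma apply_eq_one_iff (hP : ∀ i, IsRowPartialPerm (P i)) (p : Keypoint K) (m : Fin M) :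
    P p.1 p.2 m = 1 ↔ registryPoint hP p = m := by
  have h := ((hP p.1).row p.2).choose_spec
  exact ⟨fun h1 => (h.2 m h1).symm, fun h1 => h1 ▸ h.1⟩

lemma data_eq_classMatrix (hP : ∀ i, IsRowPartialPerm (P i)) :
    data P = classMatrix (registryPoint hP) := by
  have hval : ∀ (p : Keypoint K) (m : Fin M),
      P p.1 p.2 m = if registryPoint hP p = m then 1 else 0 := by
    intro p m
    by_cases h : registryPoint hP p = m
    · rw [if_pos h, apply_eq_one_iff hP, h]
    · rw [if_neg h]
      exact ((hP p.1).zero_or_one p.2 m).resolve_right fun h1 => h ((apply_eq_one_iff hP p m).1 h1)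
  ext p q
  simp [data, stack, Matrix.mul_apply, hval, classMatrix, eq_comm]

lemma ncard_registryClass (hP : ∀ i, IsRowPartialPerm (P i)) (p : Keypoint K) :
    (registryClass P (registryPoint hP p)).ncard = classCard (registryPoint hP) p := by
  rw [classCard, ← Set.ncard_coe_finset]
  congr 1
  ext q
  simp [registryClass, apply_eq_one_iff hP]

lemma registryPoint_injective_on_image (hP : ∀ i, IsRowPartialPerm (P i)) (i : Fin N)
    {a b : Fin (K i)} (h : registryPoint hP ⟨i, a⟩ = registryPoint hP ⟨i, b⟩) : a = b :=
  (hP i).column a b _ ((apply_eq_one_iff hP ⟨i, a⟩ _).2 rfl)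
    ((apply_eq_one_iff hP ⟨i, b⟩ _).2 h.symm)

/-- A column of `P i` has at most one `1`, so no two keypoints of one image share a class. -/
lemma block_gibbs (hP : ∀ i, IsRowPartialPerm (P i)) (β : ℝ) (i : Fin N) :
    block (gibbs (registryPoint hP) β) i i = 1 := by
  ext a b
  by_cases h : a = b
  · subst h; simp [block, gibbs]
  · have h1 : registryPoint hP ⟨i, a⟩ ≠ registryPoint hP ⟨i, b⟩ := fun h1 =>
      h (registryPoint_injective_on_image hP i h1)
    simp [block, gibbs, h, h1]

lemma gibbs_mem_feasible (hP : ∀ i, IsRowPartialPerm (P i)) (β : ℝ)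
    (r : Relaxation) (hK : r = Relaxation.weak → ∀ i, 0 < K i) :
    gibbs (registryPoint hP) β ∈ feasible K r := by
  have hpsd := posSemidef_gibbs (registryPoint hP) β
  cases r with
  | strong => exact ⟨block_gibbs hP β, hpsd⟩
  | weak =>
    refine ⟨gibbs_diag _ β, fun i => ?_, hpsd⟩
    -- An empty image would give trace `0` instead of `1`, leaving the weak problem infeasible.
    have : (K i : ℝ) ≠ 0 := by exact_mod_cast (hK rfl i).ne'
    rw [block_gibbs, Matrix.one_mul]
    simp [Matrix.trace, allOnes, this]
  | gw => exact ⟨gibbs_diag _ β, hpsd⟩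

lemma diag_eq_one_and_posSemidef_of_mem_feasible {r : Relaxation}
    {X : Matrix (Keypoint K) (Keypoint K) ℝ} (hX : X ∈ feasible K r) :
    (∀ p, X p p = 1) ∧ X.PosSemidef := by
  cases r with
  | strong =>
    refine ⟨fun p => ?_, hX.2⟩
    have := congrFun (congrFun (hX.1 p.1) p.2) p.2
    simpa [block] using this
  | weak => exact ⟨hX.1, hX.2.2⟩
  | gw => exact hX

lemma isRegSolution_iff (hP : ∀ i, IsRowPartialPerm (P i)) {β : ℝ} (hβ : 0 < β)
    (r : Relaxation) (hK : r = Relaxation.weak → ∀ i, 0 < K i)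
    (X : Matrix (Keypoint K) (Keypoint K) ℝ) :
    IsRegSolution r (-data P) β X ↔ X = gibbs (registryPoint hP) β := by
  have hmem := gibbs_mem_feasible hP β r hK
  rw [data_eq_classMatrix hP]
  constructor
  · rintro ⟨hX, hmin⟩
    obtain ⟨hdiag, hpsd⟩ := diag_eq_one_and_posSemidef_of_mem_feasible hX
    exact eq_gibbs_of_objective_le _ hβ hdiag hpsd (hmin hmem)
  · rintro rfl
    refine ⟨hmem, fun Y hY => ?_⟩
    obtain ⟨hdiag, hpsd⟩ := diag_eq_one_and_posSemidef_of_mem_feasible hY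
    exact objective_gibbs_le _ hβ hdiag hpsd

end Registry

end PermSync

/-! ### Unique minimizer, limit and block form -/

theorem theorem2 {N M : ℕ} (K : Fin N → ℕ) (P : ∀ i, Matrix (Fin (K i)) (Fin M) ℝ)
    (hP : ∀ i, PermSync.IsRowPartialPerm (P i))
    (r : PermSync.Relaxation) (hK : r = PermSync.Relaxation.weak → ∀ i, 0 < K i) :
    (∀ β : ℝ, 0 < β → ∃! X, PermSync.IsRegSolution r (-PermSync.data P) β X) ∧
    ∀ X : ℝ → Matrix (PermSync.Keypoint K) (PermSync.Keypoint K) ℝ,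
      (∀ β : ℝ, 0 < β → PermSync.IsRegSolution r (-PermSync.data P) β (X β)) →
        Filter.Tendsto X Filter.atTop (nhds (PermSync.data P)) ∧
        ∀ β : ℝ, 0 < β →
          (∀ m m' : Fin M, m ≠ m' → ∀ p ∈ PermSync.registryClass P m,
            ∀ q ∈ PermSync.registryClass P m', X β p q = 0) ∧
          ∀ m : Fin M,
            (X β).submatrix (Subtype.val : PermSync.registryClass P m → PermSync.Keypoint K)
                (Subtype.val : PermSync.registryClass P m → PermSync.Keypoint K) =
              PermSync.mixing β (PermSync.registryClass P m).ncard •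
                  (1 : Matrix (PermSync.registryClass P m) (PermSync.registryClass P m) ℝ) +
                (1 - PermSync.mixing β (PermSync.registryClass P m).ncard) •
                  PermSync.allOnes (PermSync.registryClass P m) := by
  refine ⟨fun β hβ => ⟨PermSync.gibbs (PermSync.registryPoint hP) β,
    (PermSync.isRegSolution_iff hP hβ r hK _).2 rfl,
    fun Y hY => (PermSync.isRegSolution_iff hP hβ r hK Y).1 hY⟩, fun X hX => ?_⟩
  have hXeq : ∀ β : ℝ, 0 < β → X β = PermSync.gibbs (PermSync.registryPoint hP) β :=
    fun β hβ => (PermSync.isRegSolution_iff hP hβ r hK _).1 (hX β hβ)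
  refine ⟨?_, fun β hβ => ⟨fun m m' hm p hp q hq => ?_, fun m => ?_⟩⟩
  · rw [PermSync.data_eq_classMatrix hP]
    -- `X β` is determined only for `β > 0`, which suffices at infinity.
    refine (PermSync.tendsto_gibbs _).congr' ?_
    filter_upwards [Filter.eventually_gt_atTop 0] with β hβ using (hXeq β hβ).symm
  · have hp' := (PermSync.apply_eq_one_iff hP p m).1 hp
    have hq' := (PermSync.apply_eq_one_iff hP q m').1 hq
    have hc : PermSync.registryPoint hP p ≠ PermSync.registryPoint hP q := by
      rw [hp', hq']; exact hm
    have hpq : p ≠ q := fun h => hc (h ▸ rfl)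
    simp [hXeq β hβ, PermSync.gibbs, hpq, hc]
  · ext p q
    have hp := (PermSync.apply_eq_one_iff hP p.1 m).1 p.2
    have hq := (PermSync.apply_eq_one_iff hP q.1 m).1 q.2
    have hcard : (PermSync.registryClass P m).ncard =
        PermSync.classCard (PermSync.registryPoint hP) p.1 := by
      rw [← PermSync.ncard_registryClass hP, hp]
    rw [hcard, hXeq β hβ]
    by_cases h : p = q
    · subst h; simp [PermSync.gibbs, PermSync.allOnes]
    · have h' : p.1 ≠ q.1 := fun h1 => h (Subtype.ext h1)
      simp [PermSync.gibbs, PermSync.allOnes, h, h', hp, hq]
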